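/- Let $n_1\le n_2$, let $\mathcal{A}:\mathbb{R}^{n_1\times n_2}\to\mathbb{R}^m$ be linear with nullspace $\mathcal{N}(\mathcal{A})$, let $0<p<1$ and $0\le k\le n_1$. For $X\in\mathbb{R}^{n_1\times n_2}$ let $\sigma_1(X)\ge\dots\ge\sigma_{n_1}(X)\ge 0$ be its singular values, put $\sigma_i(X)=0$ for $i>n_1$, and let $\operatorname{Tr}|X|^p=\sum_{i=1}^{n_1}\sigma_i^p(X)$. For $X_0\in\mathbb{R}^{n_1\times n_2}$ consider the problem $$\text{minimize } \operatorname{Tr}|X|^p\quad\text{subject to}\quad \mathcal{A}(X)=\mathcal{A}(X_0).\qquad (\ast)$$ (Sufficiency) If $$\sum_{i=1}^{2k}\sigma_i^p(W)\le\sum_{i=2k+1}^{n_1}\sigma_i^p(W)\quad\text{for all } W\in\mathcal{N}(\mathcal{A}),$$ then for every $X_0$ with $\operatorname{rank}(X_0)=k$ the matrix $X_0$ is the unique global minimizer of $(\ast)$. (Necessity) If every $X_0$ with $\operatorname{rank}(X_0)=k$ is a global minimizer of its problem $(\ast)$ (in particular, if it is always the unique one), then $$\sum_{i=1}^{k}\sigma_i^p(W)\le\sum_{i=k+1}^{n_1}\sigma_i^p(W)\quad\text{for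 all } W\in\mathcal{N}(\mathcal{A}).$$ -/

import Mathlib

namespace SchattenRecovery

/-- Singular values of a real matrix in decreasing order, with multiplicity, indexed from `0`:
`sigma X i` is the `(i + 1)`-st largest singular value, and it is `0` for `i ≥ min n₁ n₂`. -/
noncomputable def sigma {n₁ n₂ : ℕ} (X : Matrix (Fin n₁) (Fin n₂) ℝ) (i : ℕ) : ℝ :=
  (Matrix.toEuclideanLin X).singularValues i

/-- The Schatten-`p` objective `Tr |X| ^ p`, the sum of the `p`-th powers of the `n₁` singular
values of an `n₁ × n₂` matrix, where `n₁ ≤ n₂`. -/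
noncomputable def schattenPow {n₁ n₂ : ℕ} (p : ℝ) (X : Matrix (Fin n₁) (Fin n₂) ℝ) : ℝ :=
  ∑ i ∈ Finset.range n₁, sigma X i ^ p

/-- `X` is a global minimizer of `Tr |Z| ^ p` subject to `𝒜 Z = y`. -/
def IsGlobalMinimizer {n₁ n₂ m : ℕ} (𝒜 : Matrix (Fin n₁) (Fin n₂) ℝ →ₗ[ℝ] (Fin m → ℝ))
    (p : ℝ) (y : Fin m → ℝ) (X : Matrix (Fin n₁) (Fin n₂) ℝ) : Prop :=
  𝒜 X = y ∧ IsMinOn (schattenPow p) {Z | 𝒜 Z = y} X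

end SchattenRecovery

/-!
By Ky Fan duality `∑ σ_i` is subadditive, and by Weyl's inequality and truncation of the singular
value decomposition `∑ min σ_i(T) t` is the minimum of `∑ σ_i(S) + t * rank R` over all `S + R = T`,
so it is subadditive as well. Since `x ^ p` is proportional to `∫ min x t * t ^ (p - 2)` over
`t > 0`, this gives the Rotfeld inequality `Tr |A + B| ^ p ≤ Tr |A| ^ p + Tr |B| ^ p`.

For sufficiency, apply it to `T = P (T + W) - P W`, where `P` is the orthogonal projection onto the
range of `T`: the `k` largest singular values of `T + W` and of `W` together dominate
`Tr |T| ^ p`, while Weyl's inequality bounds the remaining singular values of `T + W` below by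
those of `W` with index at least `2 * k`. For necessity, minimality passes from rank `k` to lower
rank by small rank-one perturbations, and is then tested at `-R`, where `R` is the rank-`k`
truncation of `W`.
-/

namespace SchattenRecovery

open Finset Module
open scoped InnerProductSpace

section Rank

variable {K V W : Type*} [Field K] [AddCommGroup V] [Module K V] [AddCommGroup W] [Module K W]

theorem finrank_range_add_le [FiniteDimensional K V] (S T : V →ₗ[K] W) :
    finrank K (S + T).range ≤ finrank K S.range + finrank K T.range :=
  (Submodule.finrank_mono (LinearMap.range_add_le S T)).trans
    (Submodule.finrank_add_le_finrank_add_finrank _ _)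

theorem finrank_range_comp_le_left {W' : Type*} [AddCommGroup W'] [Module K W']
    [FiniteDimensional K W] (S : W →ₗ[K] W') (T : V →ₗ[K] W) :
    finrank K (S ∘ₗ T).range ≤ finrank K S.range :=
  Submodule.finrank_mono (LinearMap.range_comp_le_range T S)

theorem finrank_span_image_le_card {ι : Type*} (v : ι → V) (s : Finset ι) :
    finrank K (Submodule.span K (v '' s)) ≤ #s := by
  classical
  rw [← coe_image]
  exact (finrank_span_finset_le_card _).trans card_image_le

theorem exists_forall_finrank_range_add_smul_eq [FiniteDimensional K V]
    [FiniteDimensional K W] (T : V →ₗ[K] W)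
    (hV : finrank K T.range < finrank K V) (hW : finrank K T.range < finrank K W) :
    ∃ Q : V →ₗ[K] W, ∀ c : K, c ≠ 0 → finrank K (T + c • Q).range = finrank K T.range + 1 := by
  obtain ⟨x, hx, hx₀⟩ : ∃ x ∈ T.ker, x ≠ 0 := by
    refine Submodule.exists_mem_ne_zero_of_ne_bot fun hker => ?_
    have := T.finrank_range_add_finrank_ker
    rw [hker, finrank_bot] at this
    lia
  obtain ⟨y, hy⟩ := Submodule.exists_of_finrank_lt _ hW
  obtain ⟨φ, hφ⟩ := Projective.exists_dual_ne_zero K hx₀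
  have hyT : y ∉ T.range := by simpa using hy 1 one_ne_zero
  refine ⟨φ.smulRight y, fun c hc => ?_⟩
  have happly : ∀ z, (T + c • φ.smulRight y) z = T z + (c * φ z) • y := fun z => by
    simp [mul_smul]
  have hy_mem : y ∈ (T + c • φ.smulRight y).range :=
    ⟨(c * φ x)⁻¹ • x, by
      rw [map_smul, happly, LinearMap.mem_ker.1 hx, zero_add,
        inv_smul_smul₀ (mul_ne_zero hc hφ)]⟩
  have hrange : (T + c • φ.smulRight y).range = T.range ⊔ K ∙ y := by
    refine le_antisymm ?_ (sup_le ?_ ((Submodule.span_singleton_le_iff_mem _ _).2 hy_mem))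
    · rintro _ ⟨z, rfl⟩
      rw [happly]
      exact Submodule.add_mem_sup (LinearMap.mem_range_self T z)
        (Submodule.smul_mem _ _ (Submodule.mem_span_singleton_self y))
    · rintro _ ⟨z, rfl⟩
      have hz := happly z
      rw [← sub_eq_iff_eq_add] at hz
      exact hz ▸ Submodule.sub_mem _ (LinearMap.mem_range_self _ z)
        (Submodule.smul_mem _ _ hy_mem)
  rw [hrange, Submodule.finrank_sup_span_singleton hyT]

end Rank

section Minimax

variable {𝕜 E F : Type*} [RCLike 𝕜] [NormedAddCommGroup E] [InnerProductSpace 𝕜 E]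

theorem inner_eq_zero_of_mem_orthogonal_span_image {ι : Type*} {v : ι → E} {s : Set ι} {x : E}
    (hx : x ∈ (Submodule.span 𝕜 (v '' s))ᗮ) {i : ι} (hi : i ∈ s) : ⟪v i, x⟫_𝕜 = 0 :=
  hx _ (Submodule.subset_span (Set.mem_image_of_mem v hi))

variable [FiniteDimensional 𝕜 E] [NormedAddCommGroup F] [InnerProductSpace 𝕜 F]
  [FiniteDimensional 𝕜 F]

theorem finrank_le_finrank_orthogonal_span_image_add_card {ι : Type*} (v : ι → E)
    (s : Finset ι) :
    finrank 𝕜 E ≤ finrank 𝕜 (Submodule.span 𝕜 (v '' s))ᗮ + #s := by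
  have := finrank_span_image_le_card (K := 𝕜) v s
  have := (Submodule.span 𝕜 (v '' s)).finrank_add_finrank_orthogonal
  lia

/-- An orthonormal basis of right singular vectors of `T`, the eigenvectors of `T† T`, listed by
decreasing singular value. -/
noncomputable def rightSingularBasis (T : E →ₗ[𝕜] F) :
    OrthonormalBasis (Fin (finrank 𝕜 E)) 𝕜 E :=
  T.isSymmetric_adjoint_comp_self.eigenvectorBasis rfl

theorem inner_apply_rightSingularBasis (T : E →ₗ[𝕜] F) (x : E) (j : Fin (finrank 𝕜 E)) :
    ⟪T x, T (rightSingularBasis T j)⟫_𝕜 =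
      (T.singularValues j : 𝕜) ^ 2 * ⟪x, rightSingularBasis T j⟫_𝕜 := by
  rw [← LinearMap.adjoint_inner_right, ← LinearMap.comp_apply, rightSingularBasis,
    LinearMap.IsSymmetric.apply_eigenvectorBasis, inner_smul_right,
    ← T.sq_singularValues_fin rfl, RCLike.ofReal_pow]

theorem norm_apply_rightSingularBasis (T : E →ₗ[𝕜] F) (j : Fin (finrank 𝕜 E)) :
    ‖T (rightSingularBasis T j)‖ = T.singularValues j := by
  have hsq : ((‖T (rightSingularBasis T j)‖ ^ 2 : ℝ) : 𝕜) = (T.singularValues j ^ 2 : ℝ) := by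
    rw [RCLike.ofReal_pow, ← inner_self_eq_norm_sq_to_K, inner_apply_rightSingularBasis,
      inner_self_eq_norm_sq_to_K, (rightSingularBasis T).norm_eq_one]
    simp
  exact (pow_left_inj₀ (norm_nonneg _) (T.singularValues_nonneg j) two_ne_zero).1
    (RCLike.ofReal_injective hsq)

theorem norm_sq_apply_eq_sum (T : E →ₗ[𝕜] F) (x : E) :
    ‖T x‖ ^ 2 = ∑ j : Fin (finrank 𝕜 E),
      T.singularValues j ^ 2 * ‖⟪rightSingularBasis T j, x⟫_𝕜‖ ^ 2 := by
  have hTx : T x = ∑ j, ⟪rightSingularBasis T j, x⟫_𝕜 • T (rightSingularBasis T j) := by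
    simp only [← map_smul, ← map_sum, (rightSingularBasis T).sum_repr']
  have hinner : ⟪T x, T x⟫_𝕜 = ∑ j : Fin (finrank 𝕜 E),
      (T.singularValues j : 𝕜) ^ 2 * (‖⟪rightSingularBasis T j, x⟫_𝕜‖ : 𝕜) ^ 2 := by
    conv_lhs => rw [hTx, inner_sum]
    refine sum_congr rfl fun j _ => ?_
    rw [← hTx, inner_smul_right, inner_apply_rightSingularBasis, mul_left_comm,
      ← inner_conj_symm x, RCLike.mul_conj]
  rw [inner_self_eq_norm_sq_to_K] at hinner
  exact_mod_cast hinner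

theorem norm_apply_le_of_forall_inner_eq_zero (T : E →ₗ[𝕜] F) {i : ℕ} {x : E}
    (hx : ∀ j : Fin (finrank 𝕜 E), (j : ℕ) < i → ⟪rightSingularBasis T j, x⟫_𝕜 = 0) :
    ‖T x‖ ≤ T.singularValues i * ‖x‖ := by
  refine (sq_le_sq₀ (norm_nonneg _)
    (mul_nonneg (T.singularValues_nonneg i) (norm_nonneg _))).1 ?_
  rw [norm_sq_apply_eq_sum, mul_pow, ← (rightSingularBasis T).sum_sq_norm_inner_right x, mul_sum]
  refine sum_le_sum fun j _ => ?_
  rcases lt_or_ge (j : ℕ) i with hj | hj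
  · simp [hx j hj]
  · gcongr
    exacts [T.singularValues_nonneg _, T.singularValues_antitone hj]

theorem le_norm_apply_of_forall_inner_eq_zero (T : E →ₗ[𝕜] F) {i : ℕ} {x : E}
    (hx : ∀ j : Fin (finrank 𝕜 E), i < j → ⟪rightSingularBasis T j, x⟫_𝕜 = 0) :
    T.singularValues i * ‖x‖ ≤ ‖T x‖ := by
  refine (sq_le_sq₀ (mul_nonneg (T.singularValues_nonneg i) (norm_nonneg _))
    (norm_nonneg _)).1 ?_
  rw [norm_sq_apply_eq_sum, mul_pow, ← (rightSingularBasis T).sum_sq_norm_inner_right x, mul_sum]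
  refine sum_le_sum fun j _ => ?_
  rcases lt_or_ge i (j : ℕ) with hj | hj
  · simp [hx j hj]
  · gcongr
    exacts [T.singularValues_nonneg _, T.singularValues_antitone hj]

theorem exists_finrank_le_add_forall_inner_eq_zero {n : ℕ} (v : Fin n → E) (k i : ℕ) :
    ∃ V : Submodule 𝕜 E, finrank 𝕜 E ≤ finrank 𝕜 V + i ∧
      ∀ x ∈ V, ∀ j : Fin n, k ≤ j → j < k + i → ⟪v j, x⟫_𝕜 = 0 := by
  let s : Finset (Fin n) := {j | k ≤ j ∧ j < k + i}
  have hs : #s ≤ i := by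
    simpa using card_le_card_of_injOn (t := Ico k (k + i)) Fin.val
      (fun j hj => by simpa [s] using hj) Fin.val_injective.injOn
  exact ⟨(Submodule.span 𝕜 (v '' s))ᗮ,
    (finrank_le_finrank_orthogonal_span_image_add_card v s).trans (Nat.add_le_add_left hs _),
    fun x hx j hkj hji => inner_eq_zero_of_mem_orthogonal_span_image hx (by simp [s, hkj, hji])⟩

theorem singularValues_le_of_forall_mem_norm_le (T : E →ₗ[𝕜] F) {i : ℕ} {s : ℝ} (hs : 0 ≤ s)
    (V : Submodule 𝕜 E) (hV : finrank 𝕜 E ≤ finrank 𝕜 V + i) (h : ∀ x ∈ V, ‖T x‖ ≤ s * ‖x‖) :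
    T.singularValues i ≤ s := by
  rcases le_or_gt (finrank 𝕜 E) i with hi | hi
  · rwa [T.singularValues_of_finrank_le hi]
  let U := (Submodule.span 𝕜 (rightSingularBasis T '' (Ioi (⟨i, hi⟩ : Fin _) : Finset _)))ᗮ
  have hU : finrank 𝕜 E ≤ finrank 𝕜 U + (finrank 𝕜 E - 1 - i) := by
    simpa only [Fin.card_Ioi] using finrank_le_finrank_orthogonal_span_image_add_card (𝕜 := 𝕜)
      (rightSingularBasis T) (Ioi ⟨i, hi⟩)
  obtain ⟨x, ⟨hxU, hxV⟩, hx₀⟩ : ∃ x ∈ U ⊓ V, x ≠ 0 := by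
    refine Submodule.exists_mem_ne_zero_of_ne_bot fun hbot => ?_
    have := Submodule.finrank_add_finrank_le_of_disjoint (disjoint_iff.2 hbot)
    omega
  have hlower : T.singularValues i * ‖x‖ ≤ ‖T x‖ :=
    le_norm_apply_of_forall_inner_eq_zero T fun j hj =>
      inner_eq_zero_of_mem_orthogonal_span_image hxU (by simpa [Fin.lt_def] using hj)
  exact le_of_mul_le_mul_right (hlower.trans (h x hxV)) (norm_pos_iff.2 hx₀)

theorem exists_forall_mem_norm_le_singularValues_mul (T : E →ₗ[𝕜] F) (i : ℕ) :
    ∃ V : Submodule 𝕜 E, finrank 𝕜 E ≤ finrank 𝕜 V + i ∧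
      ∀ x ∈ V, ‖T x‖ ≤ T.singularValues i * ‖x‖ := by
  obtain ⟨V, hV, hb⟩ :=
    exists_finrank_le_add_forall_inner_eq_zero (𝕜 := 𝕜) (rightSingularBasis T) 0 i
  exact ⟨V, hV, fun x hx => norm_apply_le_of_forall_inner_eq_zero T fun j hj =>
    hb x hx j (Nat.zero_le _) (by lia)⟩

theorem singularValues_le_mul_of_forall_norm_le {S T : E →ₗ[𝕜] F} {C : ℝ} (hC : 0 ≤ C)
    (h : ∀ x, ‖S x‖ ≤ C * ‖T x‖) (i : ℕ) : S.singularValues i ≤ C * T.singularValues i := by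
  obtain ⟨V, hV, hT⟩ := exists_forall_mem_norm_le_singularValues_mul T i
  refine singularValues_le_of_forall_mem_norm_le S (mul_nonneg hC (T.singularValues_nonneg i)) V hV
    fun x hx => (h x).trans ?_
  rw [mul_assoc]
  exact mul_le_mul_of_nonneg_left (hT x hx) hC

theorem singularValues_add_le_of_finrank_range_le (T R : E →ₗ[𝕜] F) {m : ℕ}
    (hR : finrank 𝕜 R.range ≤ m) (i : ℕ) :
    (T + R).singularValues (m + i) ≤ T.singularValues i := by
  obtain ⟨V, hV, hT⟩ := exists_forall_mem_norm_le_singularValues_mul T i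
  refine singularValues_le_of_forall_mem_norm_le (T + R) (T.singularValues_nonneg i) (V ⊓ R.ker)
    ?_ ?_
  · have hsup := Submodule.finrank_sup_add_finrank_inf_eq V R.ker
    have hle := (V ⊔ R.ker).finrank_le
    have hrank := R.finrank_range_add_finrank_ker
    lia
  · rintro x ⟨hxV, hxR⟩
    simpa [LinearMap.mem_ker.1 hxR] using hT x hxV

theorem inner_sub_starProjection_span_image_eq_zero {ι : Type*} {v : ι → E}
    (hv : Orthonormal 𝕜 v) (s : Set ι) (x : E) {i : ι} (hi : i ∈ s ∨ ⟪v i, x⟫_𝕜 = 0) :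
    ⟪v i, x - (Submodule.span 𝕜 (v '' s)).starProjection x⟫_𝕜 = 0 := by
  by_cases his : i ∈ s
  · exact inner_eq_zero_of_mem_orthogonal_span_image
      (Submodule.sub_starProjection_mem_orthogonal x) his
  · have hvi : v i ∈ (Submodule.span 𝕜 (v '' s))ᗮ := by
      rw [← Submodule.span_singleton_le_iff_mem]
      refine Submodule.isOrtho_span.2 ?_
      rintro _ rfl _ ⟨j, hj, rfl⟩
      exact hv.inner_eq_zero fun hij => his (hij ▸ hj)
    rw [inner_sub_right, hi.resolve_left his, zero_sub, neg_eq_zero]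
    exact Submodule.inner_left_of_mem_orthogonal (Submodule.starProjection_apply_mem _ x) hvi

theorem exists_finrank_range_le_singularValues_sub_le (T : E →ₗ[𝕜] F) (k : ℕ) :
    ∃ R : E →ₗ[𝕜] F, finrank 𝕜 R.range ≤ k ∧
      ∀ i, (T - R).singularValues i ≤ T.singularValues (k + i) := by
  let b := rightSingularBasis T
  let s : Finset (Fin (finrank 𝕜 E)) := {j | (j : ℕ) < k}
  let U : Submodule 𝕜 E := Submodule.span 𝕜 (b '' s)
  let P : E →ₗ[𝕜] E := U.starProjection
  refine ⟨T ∘ₗ P, ?_, fun i => ?_⟩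
  · calc finrank 𝕜 (T ∘ₗ P).range = finrank 𝕜 (U.map T) := by
          rw [LinearMap.range_comp, Submodule.range_starProjection]
      _ ≤ finrank 𝕜 U := Submodule.finrank_map_le T U
      _ ≤ #s := finrank_span_image_le_card b s
      _ ≤ k := Fin.card_filter_val_lt.trans_le (min_le_right _ _)
  · obtain ⟨V, hV, hVb⟩ := exists_finrank_le_add_forall_inner_eq_zero (𝕜 := 𝕜) b k i
    refine singularValues_le_of_forall_mem_norm_le _ (T.singularValues_nonneg _) V hV fun x hx => ?_
    have hinner : ∀ j : Fin (finrank 𝕜 E), (j : ℕ) < k + i → ⟪b j, x - P x⟫_𝕜 = 0 := fun j hj => by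
      refine inner_sub_starProjection_span_image_eq_zero b.orthonormal s x ?_
      rcases lt_or_ge (j : ℕ) k with hjk | hjk
      · exact .inl (by simpa [s] using hjk)
      · exact .inr (hVb x hx j hjk hj)
    have hcontr : ‖x - P x‖ ≤ ‖x‖ := by
      simpa only [P, ContinuousLinearMap.coe_coe, Submodule.starProjection_orthogonal_val]
        using Uᗮ.norm_starProjection_apply_le x
    calc ‖(T - T ∘ₗ P) x‖ = ‖T (x - P x)‖ := by simp
      _ ≤ T.singularValues (k + i) * ‖x - P x‖ := norm_apply_le_of_forall_inner_eq_zero T hinner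
      _ ≤ T.singularValues (k + i) * ‖x‖ :=
        mul_le_mul_of_nonneg_left hcontr (T.singularValues_nonneg _)

end Minimax

section SpectralSum

variable {𝕜 E F : Type*} [RCLike 𝕜] [NormedAddCommGroup E] [InnerProductSpace 𝕜 E]
  [NormedAddCommGroup F] [InnerProductSpace 𝕜 F]

theorem norm_sum_inner_mul_inner_le {ι : Type*} [Fintype ι] {v : ι → E} {u : ι → F}
    (hv : Orthonormal 𝕜 v) (hu : Orthonormal 𝕜 u) (x : E) (y : F) :
    ‖∑ i, ⟪x, v i⟫_𝕜 * ⟪u i, y⟫_𝕜‖ ≤ ‖x‖ * ‖y‖ := by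
  have hx : √(∑ i, ‖⟪x, v i⟫_𝕜‖ ^ 2) ≤ ‖x‖ := by
    simp only [norm_inner_symm x]
    exact Real.sqrt_le_iff.2 ⟨norm_nonneg x, hv.sum_inner_products_le x⟩
  have hy : √(∑ i, ‖⟪u i, y⟫_𝕜‖ ^ 2) ≤ ‖y‖ :=
    Real.sqrt_le_iff.2 ⟨norm_nonneg y, hu.sum_inner_products_le y⟩
  calc ‖∑ i, ⟪x, v i⟫_𝕜 * ⟪u i, y⟫_𝕜‖ ≤ ∑ i, ‖⟪x, v i⟫_𝕜‖ * ‖⟪u i, y⟫_𝕜‖ :=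
        (norm_sum_le _ _).trans_eq (sum_congr rfl fun i _ => norm_mul _ _)
    _ ≤ √(∑ i, ‖⟪x, v i⟫_𝕜‖ ^ 2) * √(∑ i, ‖⟪u i, y⟫_𝕜‖ ^ 2) :=
        Real.sum_mul_le_sqrt_mul_sqrt _ _ _
    _ ≤ ‖x‖ * ‖y‖ := mul_le_mul hx hy (Real.sqrt_nonneg _) (norm_nonneg x)

variable [FiniteDimensional 𝕜 E] [FiniteDimensional 𝕜 F]

/-- The trace `Tr f(|T|)` for a function `f` with `f 0 = 0`, as the sum of `f` over the nonzero
singular values of `T`. Summing up to the rank keeps the value independent of the dimensions of the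
spaces. -/
noncomputable def spectralSum (f : ℝ → ℝ) (T : E →ₗ[𝕜] F) : ℝ :=
  ∑ i ∈ range (finrank 𝕜 T.range), f (T.singularValues i)

theorem spectralSum_eq_sum_range {f : ℝ → ℝ} (hf : f 0 = 0) {T : E →ₗ[𝕜] F} {n : ℕ}
    (hn : finrank 𝕜 T.range ≤ n) : spectralSum f T = ∑ i ∈ range n, f (T.singularValues i) :=
  sum_subset (range_subset_range.2 hn) fun i _ hi => by
    rw [T.singularValues_eq_zero_iff_le_finrank_range.2 (by simpa using hi), hf]

theorem spectralSum_le_sum_range {f : ℝ → ℝ} (hf₀ : f 0 = 0) (hf : MonotoneOn f (Set.Ici 0))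
    {S : E →ₗ[𝕜] F} {n : ℕ} (hS : finrank 𝕜 S.range ≤ n) {a : ℕ → ℝ}
    (h : ∀ i, S.singularValues i ≤ a i) : spectralSum f S ≤ ∑ i ∈ range n, f (a i) := by
  rw [spectralSum_eq_sum_range hf₀ hS]
  exact sum_le_sum fun i _ =>
    hf (S.singularValues_nonneg i) ((S.singularValues_nonneg i).trans (h i)) (h i)

theorem spectralSum_le_sum_Ico {f : ℝ → ℝ} (hf₀ : f 0 = 0) (hf : MonotoneOn f (Set.Ici 0))
    {S T : E →ₗ[𝕜] F} {k n : ℕ} (hT : finrank 𝕜 T.range ≤ n)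
    (h : ∀ i, S.singularValues i ≤ T.singularValues (k + i)) :
    spectralSum f S ≤ ∑ i ∈ Ico k n, f (T.singularValues i) := by
  have hS : finrank 𝕜 S.range ≤ n - k := by
    rw [← S.singularValues_eq_zero_iff_le_finrank_range]
    refine le_antisymm ((h _).trans_eq ?_) (S.singularValues_nonneg _)
    exact T.singularValues_eq_zero_iff_le_finrank_range.2 (by lia)
  rw [sum_Ico_eq_sum_range]
  exact spectralSum_le_sum_range hf₀ hf hS h

theorem norm_sum_inner_apply_le {ι : Type*} [Fintype ι] {v : ι → E} {u : ι → F}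
    (hv : Orthonormal 𝕜 v) (hu : Orthonormal 𝕜 u) (T : E →ₗ[𝕜] F) :
    ‖∑ i, ⟪u i, T (v i)⟫_𝕜‖ ≤ spectralSum id T := by
  let b := rightSingularBasis T
  have hexpand : ∀ i, ⟪u i, T (v i)⟫_𝕜 = ∑ j, ⟪b j, v i⟫_𝕜 * ⟪u i, T (b j)⟫_𝕜 := fun i => by
    conv_lhs => rw [← b.sum_repr' (v i), map_sum, inner_sum]
    simp only [map_smul, inner_smul_right]
  calc ‖∑ i, ⟪u i, T (v i)⟫_𝕜‖ = ‖∑ j, ∑ i, ⟪b j, v i⟫_𝕜 * ⟪u i, T (b j)⟫_𝕜‖ := by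
        simp only [hexpand]
        rw [sum_comm]
    _ ≤ ∑ j, ‖b j‖ * ‖T (b j)‖ :=
        norm_sum_le_of_le _ fun j _ => norm_sum_inner_mul_inner_le hv hu (b j) (T (b j))
    _ = ∑ j : Fin (finrank 𝕜 E), T.singularValues j := by
        simp only [b, norm_apply_rightSingularBasis, OrthonormalBasis.norm_eq_one, one_mul]
    _ = spectralSum id T := by
        rw [spectralSum_eq_sum_range rfl T.finrank_range_le, Finset.sum_range]
        rfl

theorem exists_orthonormal_sum_inner_apply_eq (T : E →ₗ[𝕜] F) :
    ∃ (v : Fin (finrank 𝕜 T.range) → E) (u : Fin (finrank 𝕜 T.range) → F),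
      Orthonormal 𝕜 v ∧ Orthonormal 𝕜 u ∧
        ∑ i, ⟪u i, T (v i)⟫_𝕜 = (spectralSum id T : 𝕜) := by
  let v := fun i => rightSingularBasis T (Fin.castLE T.finrank_range_le i)
  let u : Fin (finrank 𝕜 T.range) → F := fun i => (T.singularValues i : 𝕜)⁻¹ • T (v i)
  have hv : Orthonormal 𝕜 v := (rightSingularBasis T).orthonormal.comp _ (Fin.castLE_injective _)
  have hσ : ∀ i : Fin (finrank 𝕜 T.range), (T.singularValues i : 𝕜) ≠ 0 := fun i =>
    RCLike.ofReal_ne_zero.2 (T.singularValues_pos_iff_lt_finrank_range.2 i.2).ne'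
  have hinner : ∀ i j, ⟪T (v i), T (v j)⟫_𝕜 = if i = j then (T.singularValues i : 𝕜) ^ 2 else 0 :=
    fun i j => by
      rw [inner_apply_rightSingularBasis, orthonormal_iff_ite.1 hv]
      split_ifs with hij <;> simp [hij]
  refine ⟨v, u, hv, orthonormal_iff_ite.2 fun i j => ?_, ?_⟩
  · rw [inner_smul_left, inner_smul_right, hinner]
    split_ifs with hij
    · rw [hij, map_inv₀, RCLike.conj_ofReal]
      field_simp [hσ j]
    · rw [mul_zero, mul_zero]
  · rw [spectralSum, Finset.sum_range, RCLike.ofReal_sum]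
    refine sum_congr rfl fun i _ => ?_
    rw [inner_smul_left, hinner, if_pos rfl, map_inv₀, RCLike.conj_ofReal]
    field_simp [hσ i]
    rfl

theorem spectralSum_id_add_le (S T : E →ₗ[𝕜] F) :
    spectralSum id (S + T) ≤ spectralSum id S + spectralSum id T := by
  obtain ⟨v, u, hv, hu, hsum⟩ := exists_orthonormal_sum_inner_apply_eq (S + T)
  calc spectralSum id (S + T) ≤ ‖(spectralSum id (S + T) : 𝕜)‖ := by
        rw [RCLike.norm_ofReal]
        exact le_abs_self _
    _ = ‖∑ i, ⟪u i, S (v i)⟫_𝕜 + ∑ i, ⟪u i, T (v i)⟫_𝕜‖ := by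
        simp only [← hsum, LinearMap.add_apply, inner_add_right, sum_add_distrib]
    _ ≤ spectralSum id S + spectralSum id T :=
        norm_add_le_of_le (norm_sum_inner_apply_le hv hu S) (norm_sum_inner_apply_le hv hu T)

theorem spectralSum_min_add_le_of_finrank (S R : E →ₗ[𝕜] F) {t : ℝ} (ht : 0 ≤ t) :
    spectralSum (min · t) (S + R) ≤ spectralSum id S + finrank 𝕜 R.range * t := by
  let r := finrank 𝕜 R.range
  let n := finrank 𝕜 E
  calc spectralSum (min · t) (S + R)
      = ∑ i ∈ range (r + n), min ((S + R).singularValues i) t :=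
        spectralSum_eq_sum_range (f := (min · t)) (min_eq_left ht)
          ((S + R).finrank_range_le.trans (Nat.le_add_left _ _))
    _ = ∑ i ∈ range r, min ((S + R).singularValues i) t +
          ∑ i ∈ range n, min ((S + R).singularValues (r + i)) t := sum_range_add _ _ _
    _ ≤ ∑ _i ∈ range r, t + ∑ i ∈ range n, S.singularValues i :=
        add_le_add (sum_le_sum fun i _ => min_le_right _ _) (sum_le_sum fun i _ =>
          (min_le_left _ _).trans (singularValues_add_le_of_finrank_range_le S R le_rfl i))
    _ = spectralSum id S + r * t := by
        rw [spectralSum_eq_sum_range rfl S.finrank_range_le, sum_const, card_range, nsmul_eq_mul,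
          add_comm]
        rfl

theorem exists_add_eq_spectralSum_id_add_finrank_mul_le (T : E →ₗ[𝕜] F) {t : ℝ} (ht : 0 ≤ t) :
    ∃ S R : E →ₗ[𝕜] F, S + R = T ∧
      spectralSum id S + finrank 𝕜 R.range * t ≤ spectralSum (min · t) T := by
  let n := finrank 𝕜 E
  have hn : T.singularValues n ≤ t := (T.singularValues_of_finrank_le le_rfl).trans_le ht
  have hex : ∃ i, T.singularValues i ≤ t := ⟨n, hn⟩
  classical
  let j := Nat.find hex
  have hlt : ∀ i < j, t < T.singularValues i := fun i hi => not_le.1 (Nat.find_min hex hi)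
  have hle : ∀ i, j ≤ i → T.singularValues i ≤ t := fun i hi =>
    (T.singularValues_antitone hi).trans (Nat.find_spec hex)
  obtain ⟨R, hR, hS⟩ := exists_finrank_range_le_singularValues_sub_le T j
  refine ⟨T - R, R, sub_add_cancel T R, ?_⟩
  calc spectralSum id (T - R) + finrank 𝕜 R.range * t
      ≤ ∑ i ∈ Ico j n, T.singularValues i + j * t := by
        gcongr
        exact spectralSum_le_sum_Ico rfl monotoneOn_id T.finrank_range_le hS
    _ = ∑ i ∈ range j, min (T.singularValues i) t + ∑ i ∈ Ico j n, min (T.singularValues i) t := by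
        rw [sum_congr rfl fun i hi => min_eq_right (hlt i (mem_range.1 hi)).le,
          sum_congr rfl fun i hi => min_eq_left (hle i (mem_Ico.1 hi).1), sum_const, card_range,
          nsmul_eq_mul, add_comm]
    _ = spectralSum (min · t) T := by
        rw [sum_range_add_sum_Ico _ (Nat.find_min' hex hn),
          spectralSum_eq_sum_range (f := (min · t)) (min_eq_left ht) T.finrank_range_le]

theorem spectralSum_min_add_le (A B : E →ₗ[𝕜] F) {t : ℝ} (ht : 0 ≤ t) :
    spectralSum (min · t) (A + B) ≤ spectralSum (min · t) A + spectralSum (min · t) B := by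
  obtain ⟨S₁, R₁, rfl, h₁⟩ := exists_add_eq_spectralSum_id_add_finrank_mul_le A ht
  obtain ⟨S₂, R₂, rfl, h₂⟩ := exists_add_eq_spectralSum_id_add_finrank_mul_le B ht
  have hrank : (finrank 𝕜 (R₁ + R₂).range : ℝ) ≤ finrank 𝕜 R₁.range + finrank 𝕜 R₂.range :=
    mod_cast finrank_range_add_le R₁ R₂
  calc spectralSum (min · t) (S₁ + R₁ + (S₂ + R₂))
      ≤ spectralSum id (S₁ + S₂) + finrank 𝕜 (R₁ + R₂).range * t := by
        rw [add_add_add_comm]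
        exact spectralSum_min_add_le_of_finrank _ _ ht
    _ ≤ (spectralSum id S₁ + spectralSum id S₂) +
          (finrank 𝕜 R₁.range + finrank 𝕜 R₂.range) * t := by
        gcongr
        exact spectralSum_id_add_le S₁ S₂
    _ ≤ spectralSum (min · t) (S₁ + R₁) + spectralSum (min · t) (S₂ + R₂) := by linarith

end SpectralSum

section Powers

open MeasureTheory

theorem integral_Ioc_min_mul_rpow {p : ℝ} (hp₀ : 0 < p) {x : ℝ} (hx : 0 ≤ x) :
    IntegrableOn (fun t : ℝ => min x t * t ^ (p - 2)) (Set.Ioc 0 x) ∧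
      ∫ t in Set.Ioc 0 x, min x t * t ^ (p - 2) = p⁻¹ * x ^ p := by
  have heq : Set.EqOn (fun t : ℝ => t ^ (p - 1)) (fun t => min x t * t ^ (p - 2)) (Set.Ioc 0 x) :=
    fun t ht => by
      beta_reduce
      rw [min_eq_right ht.2, mul_comm, ← Real.rpow_add_one ht.1.ne']
      ring_nf
  have hint : IntegrableOn (fun t : ℝ => t ^ (p - 1)) (Set.Ioc 0 x) :=
    (intervalIntegrable_iff_integrableOn_Ioc_of_le hx).1
      (intervalIntegral.intervalIntegrable_rpow' (by linarith))
  refine ⟨hint.congr_fun heq measurableSet_Ioc, ?_⟩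
  rw [← setIntegral_congr_fun measurableSet_Ioc heq, ← intervalIntegral.integral_of_le hx,
    integral_rpow (Or.inl (by linarith)), sub_add_cancel, Real.zero_rpow hp₀.ne', sub_zero,
    div_eq_inv_mul]

theorem integral_Ioi_min_mul_rpow {p : ℝ} (hp₁ : p < 1) {x : ℝ} (hx : 0 < x) :
    IntegrableOn (fun t : ℝ => min x t * t ^ (p - 2)) (Set.Ioi x) ∧
      ∫ t in Set.Ioi x, min x t * t ^ (p - 2) = (1 - p)⁻¹ * x ^ p := by
  have heq : Set.EqOn (fun t : ℝ => x * t ^ (p - 2)) (fun t => min x t * t ^ (p - 2)) (Set.Ioi x) :=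
    fun t ht => by simp only [min_eq_left (Set.mem_Ioi.1 ht).le]
  have hint : IntegrableOn (fun t : ℝ => x * t ^ (p - 2)) (Set.Ioi x) :=
    (integrableOn_Ioi_rpow_of_lt (by linarith) hx).const_mul x
  refine ⟨hint.congr_fun heq measurableSet_Ioi, ?_⟩
  have hpow : x * x ^ (p - 2 + 1) = x ^ p := by
    rw [mul_comm, ← Real.rpow_add_one hx.ne']
    ring_nf
  rw [← setIntegral_congr_fun measurableSet_Ioi heq, integral_const_mul,
    integral_Ioi_rpow_of_lt (by linarith) hx, ← hpow,
    show p - 2 + 1 = -(1 - p) by ring]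
  field_simp

theorem integral_Ioi_zero_min_mul_rpow {p : ℝ} (hp₀ : 0 < p) (hp₁ : p < 1) {x : ℝ} (hx : 0 ≤ x) :
    IntegrableOn (fun t : ℝ => min x t * t ^ (p - 2)) (Set.Ioi 0) ∧
      ∫ t in Set.Ioi (0 : ℝ), min x t * t ^ (p - 2) = (p⁻¹ + (1 - p)⁻¹) * x ^ p := by
  rcases hx.eq_or_lt with rfl | hx
  · have hzero : Set.EqOn (fun _ => 0) (fun t : ℝ => min 0 t * t ^ (p - 2)) (Set.Ioi 0) :=
      fun t ht => by simp only [min_eq_left (Set.mem_Ioi.1 ht).le, zero_mul]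
    refine ⟨integrableOn_zero.congr_fun hzero measurableSet_Ioi, ?_⟩
    rw [← setIntegral_congr_fun measurableSet_Ioi hzero, integral_zero, Real.zero_rpow hp₀.ne',
      mul_zero]
  · obtain ⟨hint_Ioc, hIoc⟩ := integral_Ioc_min_mul_rpow hp₀ hx.le
    obtain ⟨hint_Ioi, hIoi⟩ := integral_Ioi_min_mul_rpow hp₁ hx
    rw [← Set.Ioc_union_Ioi_eq_Ioi hx.le]
    refine ⟨hint_Ioc.union hint_Ioi, ?_⟩
    rw [setIntegral_union (Set.Ioc_disjoint_Ioi le_rfl) measurableSet_Ioi hint_Ioc hint_Ioi, hIoc,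
      hIoi, add_mul]

variable {𝕜 E F : Type*} [RCLike 𝕜] [NormedAddCommGroup E] [InnerProductSpace 𝕜 E]
  [FiniteDimensional 𝕜 E] [NormedAddCommGroup F] [InnerProductSpace 𝕜 F] [FiniteDimensional 𝕜 F]
  {p : ℝ}

theorem integral_spectralSum_min_mul_rpow (hp₀ : 0 < p) (hp₁ : p < 1) (T : E →ₗ[𝕜] F) :
    IntegrableOn (fun t : ℝ => spectralSum (min · t) T * t ^ (p - 2)) (Set.Ioi 0) ∧
      ∫ t in Set.Ioi (0 : ℝ), spectralSum (min · t) T * t ^ (p - 2) =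
        (p⁻¹ + (1 - p)⁻¹) * spectralSum (· ^ p) T := by
  have hint := fun i => integral_Ioi_zero_min_mul_rpow hp₀ hp₁ (T.singularValues_nonneg i)
  simp only [spectralSum, sum_mul, mul_sum]
  refine ⟨integrable_finsetSum _ fun i _ => (hint i).1, ?_⟩
  rw [integral_finsetSum _ fun i _ => (hint i).1]
  exact sum_congr rfl fun i _ => (hint i).2

theorem spectralSum_rpow_add_le (hp₀ : 0 < p) (hp₁ : p ≤ 1) (A B : E →ₗ[𝕜] F) :
    spectralSum (· ^ p) (A + B) ≤ spectralSum (· ^ p) A + spectralSum (· ^ p) B := by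
  rcases hp₁.eq_or_lt with rfl | hp₁
  · simp only [Real.rpow_one]
    exact spectralSum_id_add_le A B
  obtain ⟨hint, hsum⟩ := integral_spectralSum_min_mul_rpow hp₀ hp₁ (A + B)
  obtain ⟨hintA, hA⟩ := integral_spectralSum_min_mul_rpow hp₀ hp₁ A
  obtain ⟨hintB, hB⟩ := integral_spectralSum_min_mul_rpow hp₀ hp₁ B
  have hle := setIntegral_mono_on hint (hintA.add hintB) measurableSet_Ioi fun t ht => by
    rw [Pi.add_apply, ← add_mul]
    exact mul_le_mul_of_nonneg_right (spectralSum_min_add_le A B (Set.mem_Ioi.1 ht).le)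
      (Real.rpow_nonneg (Set.mem_Ioi.1 ht).le _)
  simp only [Pi.add_apply] at hle
  rw [integral_add hintA hintB, hsum, hA, hB, ← mul_add] at hle
  exact le_of_mul_le_mul_left hle (add_pos (inv_pos.2 hp₀) (inv_pos.2 (sub_pos.2 hp₁)))

theorem singularValues_smul_le (c : 𝕜) (T : E →ₗ[𝕜] F) (i : ℕ) :
    (c • T).singularValues i ≤ ‖c‖ * T.singularValues i :=
  singularValues_le_mul_of_forall_norm_le (norm_nonneg c)
    (fun x => (norm_smul c (T x)).le) i

theorem spectralSum_rpow_smul_le (hp₀ : 0 < p) (c : 𝕜) (T : E →ₗ[𝕜] F) :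
    spectralSum (· ^ p) (c • T) ≤ ‖c‖ ^ p * spectralSum (· ^ p) T := by
  have hrank : finrank 𝕜 (c • T).range ≤ finrank 𝕜 T.range :=
    Submodule.finrank_mono (LinearMap.range_smul_le_range T c)
  refine (spectralSum_le_sum_range (f := (· ^ p)) (Real.zero_rpow hp₀.ne')
    (Real.monotoneOn_rpow_Ici_of_exponent_nonneg hp₀.le) hrank
    (singularValues_smul_le c T)).trans_eq ?_
  rw [spectralSum, mul_sum]
  exact sum_congr rfl fun i _ => Real.mul_rpow (norm_nonneg c) (T.singularValues_nonneg i)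

end Powers

section NullspaceCondition

open Filter Topology

theorem sum_range_lt_sum_Ico_of_sum_range_two_mul_le {a : ℕ → ℝ} (ha : Antitone a)
    (ha_nonneg : ∀ i, 0 ≤ a i) (ha_pos : 0 < a 0) {k n : ℕ} (hn : 0 < n)
    (h : ∑ i ∈ range (2 * k), a i ≤ ∑ i ∈ Ico (2 * k) n, a i) :
    ∑ i ∈ range k, a i < ∑ i ∈ Ico (2 * k) n, a i := by
  rcases k.eq_zero_or_pos with rfl | hk
  · rw [range_zero, sum_empty]
    exact sum_pos' (fun i _ => ha_nonneg i) ⟨0, by simpa using hn, ha_pos⟩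
  have hak : 0 < a k := (ha_nonneg k).lt_of_ne fun hak => by
    have htail : ∑ i ∈ Ico (2 * k) n, a i ≤ 0 := sum_nonpos fun i hi =>
      (ha (by have := mem_Ico.1 hi; lia)).trans_eq hak.symm
    have hhead : 0 < ∑ i ∈ range (2 * k), a i :=
      sum_pos' (fun i _ => ha_nonneg i) ⟨0, by simpa using hk, ha_pos⟩
    linarith
  have hmid : 0 < ∑ i ∈ Ico k (2 * k), a i :=
    sum_pos' (fun i _ => ha_nonneg i) ⟨k, mem_Ico.2 ⟨le_rfl, by lia⟩, hak⟩
  rw [← sum_range_add_sum_Ico a (by lia : k ≤ 2 * k)] at h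
  linarith

variable {𝕜 E F : Type*} [RCLike 𝕜] [NormedAddCommGroup E] [InnerProductSpace 𝕜 E]
  [FiniteDimensional 𝕜 E] [NormedAddCommGroup F] [InnerProductSpace 𝕜 F] [FiniteDimensional 𝕜 F]
  {p : ℝ}

theorem spectralSum_rpow_le_sum_range_of_norm_le (hp₀ : 0 < p) {S T : E →ₗ[𝕜] F} {k : ℕ}
    (hS : finrank 𝕜 S.range ≤ k) (h : ∀ x, ‖S x‖ ≤ ‖T x‖) :
    spectralSum (· ^ p) S ≤ ∑ i ∈ range k, T.singularValues i ^ p :=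
  spectralSum_le_sum_range (f := (· ^ p)) (Real.zero_rpow hp₀.ne')
    (Real.monotoneOn_rpow_Ici_of_exponent_nonneg hp₀.le) hS fun i => by
      simpa only [one_mul] using
        singularValues_le_mul_of_forall_norm_le zero_le_one (by simpa only [one_mul] using h) i

theorem spectralSum_rpow_le_sum_range_add (hp₀ : 0 < p) (hp₁ : p ≤ 1) {T W : E →ₗ[𝕜] F} {k : ℕ}
    (hT : finrank 𝕜 T.range ≤ k) :
    spectralSum (· ^ p) T ≤
      ∑ i ∈ range k, (T + W).singularValues i ^ p + ∑ i ∈ range k, W.singularValues i ^ p := by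
  let P : F →ₗ[𝕜] F := T.range.starProjection
  have hPT : ∀ x, P (T x) = T x := fun x =>
    Submodule.starProjection_eq_self_iff.2 (T.mem_range_self x)
  have hrank : ∀ Z : E →ₗ[𝕜] F, finrank 𝕜 (P ∘ₗ Z).range ≤ k := fun Z => by
    refine (finrank_range_comp_le_left P Z).trans ?_
    rwa [Submodule.range_starProjection]
  have hnorm : ∀ y, ‖P y‖ ≤ ‖y‖ := T.range.norm_starProjection_apply_le
  calc spectralSum (· ^ p) T = spectralSum (· ^ p) (P ∘ₗ (T + W) + P ∘ₗ (-W)) := by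
        congr 1
        ext x
        simp [hPT]
    _ ≤ spectralSum (· ^ p) (P ∘ₗ (T + W)) + spectralSum (· ^ p) (P ∘ₗ (-W)) :=
        spectralSum_rpow_add_le hp₀ hp₁ _ _
    _ ≤ _ := add_le_add
        (spectralSum_rpow_le_sum_range_of_norm_le hp₀ (hrank _) fun x => hnorm _)
        (spectralSum_rpow_le_sum_range_of_norm_le hp₀ (hrank _) fun x => by
          simpa only [LinearMap.comp_apply, LinearMap.neg_apply, norm_neg] using hnorm ((-W) x))

theorem sum_Ico_two_mul_singularValues_rpow_le (hp₀ : 0 < p) {T W : E →ₗ[𝕜] F} {k n : ℕ}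
    (hT : finrank 𝕜 T.range ≤ k) :
    ∑ i ∈ Ico (2 * k) n, W.singularValues i ^ p ≤
      ∑ i ∈ Ico k n, (T + W).singularValues i ^ p := by
  have hweyl : ∀ i, W.singularValues (k + i) ≤ (T + W).singularValues i := fun i => by
    have hneg : finrank 𝕜 (-T).range ≤ k := by rwa [LinearMap.range_neg]
    simpa only [add_neg_cancel_comm] using
      singularValues_add_le_of_finrank_range_le (T + W) (-T) hneg i
  calc ∑ i ∈ Ico (2 * k) n, W.singularValues i ^ p
      = ∑ i ∈ Ico k (n - k), W.singularValues (k + i) ^ p := by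
        simp only [sum_Ico_eq_sum_range, two_mul, Nat.sub_sub, add_assoc]
    _ ≤ ∑ i ∈ Ico k (n - k), (T + W).singularValues i ^ p :=
        sum_le_sum fun i _ => Real.rpow_le_rpow (W.singularValues_nonneg _) (hweyl i) hp₀.le
    _ ≤ ∑ i ∈ Ico k n, (T + W).singularValues i ^ p :=
        sum_le_sum_of_subset_of_nonneg (Ico_subset_Ico_right (Nat.sub_le n k)) fun i _ _ =>
          Real.rpow_nonneg ((T + W).singularValues_nonneg i) p

theorem spectralSum_rpow_lt_spectralSum_rpow_add (hp₀ : 0 < p) (hp₁ : p ≤ 1) {T W : E →ₗ[𝕜] F}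
    {k n : ℕ} (hkn : k ≤ n) (hT : finrank 𝕜 T.range ≤ k) (hTW : finrank 𝕜 (T + W).range ≤ n)
    (hW : finrank 𝕜 W.range ≤ n) (hW₀ : W ≠ 0)
    (hnull : ∑ i ∈ range (2 * k), W.singularValues i ^ p ≤
      ∑ i ∈ Ico (2 * k) n, W.singularValues i ^ p) :
    spectralSum (· ^ p) T < spectralSum (· ^ p) (T + W) := by
  have hrank : 0 < finrank 𝕜 W.range :=
    Submodule.one_le_finrank_iff.2 (LinearMap.range_eq_bot.not.2 hW₀)
  have hσ₀ : 0 < W.singularValues 0 := W.singularValues_pos_iff_lt_finrank_range.2 hrank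
  calc spectralSum (· ^ p) T
      ≤ ∑ i ∈ range k, (T + W).singularValues i ^ p + ∑ i ∈ range k, W.singularValues i ^ p :=
        spectralSum_rpow_le_sum_range_add hp₀ hp₁ hT
    _ < ∑ i ∈ range k, (T + W).singularValues i ^ p +
          ∑ i ∈ Ico (2 * k) n, W.singularValues i ^ p :=
        add_lt_add_right (sum_range_lt_sum_Ico_of_sum_range_two_mul_le
          (fun i j hij => Real.rpow_le_rpow (W.singularValues_nonneg j)
            (W.singularValues_antitone hij) hp₀.le)
          (fun i => Real.rpow_nonneg (W.singularValues_nonneg i) p) (Real.rpow_pos_of_pos hσ₀ p)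
          (hrank.trans_le hW) hnull) _
    _ ≤ ∑ i ∈ range k, (T + W).singularValues i ^ p +
          ∑ i ∈ Ico k n, (T + W).singularValues i ^ p :=
        add_le_add_right (sum_Ico_two_mul_singularValues_rpow_le hp₀ hT) _
    _ = spectralSum (· ^ p) (T + W) := by
        rw [sum_range_add_sum_Ico _ hkn,
          spectralSum_eq_sum_range (f := (· ^ p)) (Real.zero_rpow hp₀.ne') hTW]

theorem spectralSum_rpow_le_add_of_forall_finrank_eq_succ (hp₀ : 0 < p) (hp₁ : p ≤ 1)
    {T W : E →ₗ[𝕜] F} (hE : finrank 𝕜 T.range < finrank 𝕜 E)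
    (hF : finrank 𝕜 T.range < finrank 𝕜 F)
    (h : ∀ Z : E →ₗ[𝕜] F, finrank 𝕜 Z.range = finrank 𝕜 T.range + 1 →
      spectralSum (· ^ p) Z ≤ spectralSum (· ^ p) (Z + W)) :
    spectralSum (· ^ p) T ≤ spectralSum (· ^ p) (T + W) := by
  obtain ⟨Q, hQ⟩ := exists_forall_finrank_range_add_smul_eq T hE hF
  let δ : ℝ → ℝ := fun ε => ε ^ p * spectralSum (· ^ p) Q
  have hperturb : ∀ c : 𝕜, ∀ Z : E →ₗ[𝕜] F,
      spectralSum (· ^ p) (Z + c • Q) ≤ spectralSum (· ^ p) Z + δ ‖c‖ := fun c Z =>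
    (spectralSum_rpow_add_le hp₀ hp₁ Z (c • Q)).trans
      (add_le_add_right (spectralSum_rpow_smul_le hp₀ c Q) _)
  have hbound : ∀ ε : ℝ, 0 < ε →
      spectralSum (· ^ p) T ≤ spectralSum (· ^ p) (T + W) + δ ε + δ ε := fun ε hε => by
    let c : 𝕜 := (ε : 𝕜)
    have hc : c ≠ 0 := RCLike.ofReal_ne_zero.2 hε.ne'
    have hnorm : ‖c‖ = ε := RCLike.norm_of_nonneg hε.le
    calc spectralSum (· ^ p) T = spectralSum (· ^ p) (T + c • Q + (-c) • Q) := by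
          rw [neg_smul, add_neg_cancel_right]
      _ ≤ spectralSum (· ^ p) (T + c • Q) + δ ε := by
          simpa only [norm_neg, hnorm] using hperturb (-c) (T + c • Q)
      _ ≤ spectralSum (· ^ p) (T + W + c • Q) + δ ε := by
          rw [add_right_comm T W]
          exact add_le_add_left (h _ (hQ c hc)) _
      _ ≤ spectralSum (· ^ p) (T + W) + δ ε + δ ε := by
          simpa only [hnorm] using add_le_add_left (hperturb c (T + W)) (δ ε)
  have hδ : Tendsto δ (𝓝[>] 0) (𝓝 0) := by
    have hcont : Continuous δ := (Real.continuous_rpow_const hp₀.le).mul_const _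
    exact (hcont.tendsto' 0 0 (by simp [δ, Real.zero_rpow hp₀.ne'])).mono_left nhdsWithin_le_nhds
  have hlim : Tendsto (fun ε => spectralSum (· ^ p) (T + W) + δ ε + δ ε) (𝓝[>] 0)
      (𝓝 (spectralSum (· ^ p) (T + W))) := by
    simpa only [add_zero] using (tendsto_const_nhds.add hδ).add hδ
  exact ge_of_tendsto hlim (eventually_mem_nhdsWithin.mono hbound)

theorem spectralSum_rpow_le_add_of_forall_finrank_eq (hp₀ : 0 < p) (hp₁ : p ≤ 1)
    {W : E →ₗ[𝕜] F} {k : ℕ} (hE : k ≤ finrank 𝕜 E) (hF : k ≤ finrank 𝕜 F)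
    (h : ∀ T : E →ₗ[𝕜] F, finrank 𝕜 T.range = k →
      spectralSum (· ^ p) T ≤ spectralSum (· ^ p) (T + W))
    {T : E →ₗ[𝕜] F} (hT : finrank 𝕜 T.range ≤ k) :
    spectralSum (· ^ p) T ≤ spectralSum (· ^ p) (T + W) := by
  induction hr : k - finrank 𝕜 T.range generalizing T with
  | zero => exact h T (by lia)
  | succ d ih =>
    exact spectralSum_rpow_le_add_of_forall_finrank_eq_succ hp₀ hp₁ (by lia) (by lia)
      fun Z hZ => ih (by lia) (by lia)

theorem sum_range_le_sum_Ico_of_forall_spectralSum_rpow_le_add (hp₀ : 0 < p) (hp₁ : p ≤ 1)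
    {W : E →ₗ[𝕜] F} {k n : ℕ} (hkn : k ≤ n) (hW : finrank 𝕜 W.range ≤ n)
    (h : ∀ T : E →ₗ[𝕜] F, finrank 𝕜 T.range ≤ k →
      spectralSum (· ^ p) T ≤ spectralSum (· ^ p) (T + W)) :
    ∑ i ∈ range k, W.singularValues i ^ p ≤ ∑ i ∈ Ico k n, W.singularValues i ^ p := by
  obtain ⟨R, hR, hWR⟩ := exists_finrank_range_le_singularValues_sub_le W k
  have hzero : (0 : ℝ) ^ p = 0 := Real.zero_rpow hp₀.ne'
  have htail : spectralSum (· ^ p) (W - R) ≤ ∑ i ∈ Ico k n, W.singularValues i ^ p :=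
    spectralSum_le_sum_Ico (f := (· ^ p)) hzero
      (Real.monotoneOn_rpow_Ici_of_exponent_nonneg hp₀.le) hW hWR
  have hneg : spectralSum (· ^ p) R ≤ spectralSum (· ^ p) (-R) := by
    simpa using spectralSum_rpow_smul_le hp₀ (-1 : 𝕜) (-R)
  have hmin : spectralSum (· ^ p) (-R) ≤ spectralSum (· ^ p) (W - R) := by
    simpa only [neg_add_eq_sub] using h (-R) (by rwa [LinearMap.range_neg])
  have hsplit : spectralSum (· ^ p) W ≤ spectralSum (· ^ p) (W - R) + spectralSum (· ^ p) R := by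
    simpa only [sub_add_cancel] using spectralSum_rpow_add_le hp₀ hp₁ (W - R) R
  rw [spectralSum_eq_sum_range (f := (· ^ p)) hzero hW, ← sum_range_add_sum_Ico _ hkn] at hsplit
  linarith

end NullspaceCondition

section Matrix

open Matrix (toEuclideanLin)

variable {𝕜 : Type*} [RCLike 𝕜] {n₁ n₂ : ℕ} {p : ℝ} {k : ℕ}

theorem rank_eq_finrank_range_toEuclideanLin (X : Matrix (Fin n₁) (Fin n₂) 𝕜) :
    X.rank = finrank 𝕜 (toEuclideanLin X).range :=
  X.rank_eq_finrank_range_toLin (PiLp.basisFun 2 𝕜 _) (PiLp.basisFun 2 𝕜 _)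

theorem finrank_range_toEuclideanLin_le (X : Matrix (Fin n₁) (Fin n₂) 𝕜) :
    finrank 𝕜 (toEuclideanLin X).range ≤ n₁ := by
  simpa only [finrank_euclideanSpace_fin] using (toEuclideanLin X).range.finrank_le

theorem spectralSum_rpow_toEuclideanLin (hp₀ : 0 < p) (X : Matrix (Fin n₁) (Fin n₂) 𝕜) :
    spectralSum (· ^ p) (toEuclideanLin X) =
      ∑ i ∈ range n₁, (toEuclideanLin X).singularValues i ^ p :=
  spectralSum_eq_sum_range (f := (· ^ p)) (Real.zero_rpow hp₀.ne')
    (finrank_range_toEuclideanLin_le X)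

theorem sum_singularValues_rpow_lt_add_of_rank_le (hp₀ : 0 < p) (hp₁ : p ≤ 1) (hk : k ≤ n₁)
    {X W : Matrix (Fin n₁) (Fin n₂) 𝕜} (hX : X.rank ≤ k) (hW : W ≠ 0)
    (hnull : ∑ i ∈ range (2 * k), (toEuclideanLin W).singularValues i ^ p ≤
      ∑ i ∈ Ico (2 * k) n₁, (toEuclideanLin W).singularValues i ^ p) :
    ∑ i ∈ range n₁, (toEuclideanLin X).singularValues i ^ p <
      ∑ i ∈ range n₁, (toEuclideanLin (X + W)).singularValues i ^ p := by
  have hlt := spectralSum_rpow_lt_spectralSum_rpow_add hp₀ hp₁ hk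
    (rank_eq_finrank_range_toEuclideanLin X ▸ hX)
    (by rw [← map_add]; exact finrank_range_toEuclideanLin_le (X + W))
    (finrank_range_toEuclideanLin_le W) (by simpa using hW) hnull
  rwa [← map_add, spectralSum_rpow_toEuclideanLin hp₀, spectralSum_rpow_toEuclideanLin hp₀] at hlt

theorem sum_range_le_sum_Ico_of_forall_rank_eq (hp₀ : 0 < p) (hp₁ : p ≤ 1) (hk₁ : k ≤ n₁)
    (hk₂ : k ≤ n₂) {W : Matrix (Fin n₁) (Fin n₂) 𝕜}
    (h : ∀ X : Matrix (Fin n₁) (Fin n₂) 𝕜, X.rank = k →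
      ∑ i ∈ range n₁, (toEuclideanLin X).singularValues i ^ p ≤
        ∑ i ∈ range n₁, (toEuclideanLin (X + W)).singularValues i ^ p) :
    ∑ i ∈ range k, (toEuclideanLin W).singularValues i ^ p ≤
      ∑ i ∈ Ico k n₁, (toEuclideanLin W).singularValues i ^ p := by
  refine sum_range_le_sum_Ico_of_forall_spectralSum_rpow_le_add hp₀ hp₁ hk₁
    (finrank_range_toEuclideanLin_le W) fun T hT =>
      spectralSum_rpow_le_add_of_forall_finrank_eq hp₀ hp₁ (by simpa using hk₂) (by simpa using hk₁)
        (fun Z hZ => ?_) hT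
  obtain ⟨X, rfl⟩ := toEuclideanLin.surjective Z
  rw [← map_add, spectralSum_rpow_toEuclideanLin hp₀, spectralSum_rpow_toEuclideanLin hp₀]
  exact h X (by rw [rank_eq_finrank_range_toEuclideanLin, hZ])

end Matrix

end SchattenRecovery

open Finset Matrix in
theorem theorem3_general {𝕜 G : Type*} [RCLike 𝕜] [AddGroup G] {n₁ n₂ : ℕ}
    (𝒜 : Matrix (Fin n₁) (Fin n₂) 𝕜 →+ G) {p : ℝ} (hp₀ : 0 < p) (hp₁ : p ≤ 1) {k : ℕ}
    (hk₁ : k ≤ n₁) (hk₂ : k ≤ n₂) :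
    ((∀ W, 𝒜 W = 0 →
        ∑ i ∈ range (2 * k), (toEuclideanLin W).singularValues i ^ p ≤
          ∑ i ∈ Ico (2 * k) n₁, (toEuclideanLin W).singularValues i ^ p) →
      ∀ X₀ : Matrix (Fin n₁) (Fin n₂) 𝕜, X₀.rank = k → ∀ X,
        (𝒜 X = 𝒜 X₀ ∧
          IsMinOn (fun Z => ∑ i ∈ range n₁, (toEuclideanLin Z).singularValues i ^ p)
            {Z | 𝒜 Z = 𝒜 X₀} X) ↔ X = X₀) ∧
    ((∀ X₀ : Matrix (Fin n₁) (Fin n₂) 𝕜, X₀.rank = k →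
        IsMinOn (fun Z => ∑ i ∈ range n₁, (toEuclideanLin Z).singularValues i ^ p)
          {Z | 𝒜 Z = 𝒜 X₀} X₀) →
      ∀ W, 𝒜 W = 0 →
        ∑ i ∈ range k, (toEuclideanLin W).singularValues i ^ p ≤
          ∑ i ∈ Ico k n₁, (toEuclideanLin W).singularValues i ^ p) := by
  refine ⟨fun hnull X₀ hX₀ X => ?_, fun hmin W hW => ?_⟩
  · have hlt : ∀ Z, 𝒜 Z = 𝒜 X₀ → Z ≠ X₀ →
        ∑ i ∈ range n₁, (toEuclideanLin X₀).singularValues i ^ p <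
          ∑ i ∈ range n₁, (toEuclideanLin Z).singularValues i ^ p := fun Z hZ hne => by
      have hker : 𝒜 (Z - X₀) = 0 := by rw [map_sub, hZ, sub_self]
      simpa only [add_sub_cancel] using SchattenRecovery.sum_singularValues_rpow_lt_add_of_rank_le
        hp₀ hp₁ hk₁ hX₀.le (sub_ne_zero.2 hne) (hnull _ hker)
    refine ⟨fun ⟨hX, hmin⟩ => by_contra fun hne => (hlt X hX hne).not_ge (hmin rfl), ?_⟩
    rintro rfl
    refine ⟨rfl, isMinOn_iff.2 fun Z hZ => ?_⟩
    rcases eq_or_ne Z X with rfl | hne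
    exacts [le_rfl, (hlt Z hZ hne).le]
  · exact SchattenRecovery.sum_range_le_sum_Ico_of_forall_rank_eq hp₀ hp₁ hk₁ hk₂ fun X hX =>
      hmin X hX (by simp [hW])

/-- First part: under the order-`2k` nullspace condition, every `X₀` of rank `k` is the one and only
global minimizer for the data `𝒜 X₀`. Second part: if every `X₀` of rank `k` is a global minimizer
for the data `𝒜 X₀`, then the order-`k` nullspace condition holds. -/
theorem theorem3 {n₁ n₂ m : ℕ} (hn : n₁ ≤ n₂)
    (𝒜 : Matrix (Fin n₁) (Fin n₂) ℝ →ₗ[ℝ] (Fin m → ℝ))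
    (p : ℝ) (hp₀ : 0 < p) (hp₁ : p < 1) (k : ℕ) (hk : k ≤ n₁) :
    ((∀ W ∈ LinearMap.ker 𝒜,
        ∑ i ∈ Finset.range (2 * k), SchattenRecovery.sigma W i ^ p
          ≤ ∑ i ∈ Finset.Ico (2 * k) n₁, SchattenRecovery.sigma W i ^ p) →
      ∀ X₀ : Matrix (Fin n₁) (Fin n₂) ℝ, X₀.rank = k →
        ∀ X, SchattenRecovery.IsGlobalMinimizer 𝒜 p (𝒜 X₀) X ↔ X = X₀) ∧
    ((∀ X₀ : Matrix (Fin n₁) (Fin n₂) ℝ, X₀.rank = k →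
        SchattenRecovery.IsGlobalMinimizer 𝒜 p (𝒜 X₀) X₀) →
      ∀ W ∈ LinearMap.ker 𝒜,
        ∑ i ∈ Finset.range k, SchattenRecovery.sigma W i ^ p
          ≤ ∑ i ∈ Finset.Ico k n₁, SchattenRecovery.sigma W i ^ p) := by
  have h := theorem3_general 𝒜.toAddMonoidHom hp₀ hp₁.le hk (hk.trans hn)
  exact ⟨h.1, fun hmin => h.2 fun X₀ hX₀ => (hmin X₀ hX₀).2⟩
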